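/- **Setting.** A partition of $[0,\infty)$ is a sequence $\pi=(t_k)_{k\in\mathbb N}$ in $[0,\infty]$ with $t_0=0$, $t_k<t_{k+1}$ whenever $t_{k+1}<\infty$, and $\lim_k t_k=\infty$. For $x:[0,\infty)\to\mathbb R$ let $$O_T(x,\pi)=\sup\{|x_b-x_a| : a,b\in[t_k,t_{k+1})\cap[0,T]\text{ for some }k\},$$ $$L^{\pi}_t(u)=2\sum_{k}\mathbf 1_{[\![ x_{t_k\wedge t},\,x_{t_{k+1}\wedge t})\!)}(u)\,|x_{t_{k+1}\wedge t}-u|,$$ where $[\![a,b)\!)$ is $[a,b)$ if $a\le b$ and $[b,a)$ if $a>b$. Fix a sequence of partitions $\Pi=(\pi_n)_n$. For $p\in[1,\infty]$, let $\mathcal L_p$ be the set of continuous $x:[0,\infty)\to\mathbb R$ such that $O_T(x,\pi_n)\to0$ for all $T<\infty$ and such that, for every $t\in[0,\infty)$, $(L^{\pi_n}_t)_n$ converges weakly (weakly$^*$ if $p=\infty$) in $L^p=L^p(\mathbb R,du)$ to some $L_t$, the map $t\mapsto L_t\in L^p$ being continuous on $[0,\infty)$ for the weak (weak$^*$ if $p=\infty$)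 topology. Let $W^{1,q}$ be the set of functions $g:\mathbb R\to\mathbb R$ that are absolutely continuous on compact intervals and whose a.e. derivative $g'$ belongs to $L^q$. The Föllmer integral is $$\int_0^t g(x_s)\,dx_s:=\lim_{n\to\infty}\sum_{t_j\in\pi_n}g(x_{t_j})\,(x_{t_{j+1}\wedge t}-x_{t_j\wedge t}),$$ said to exist if the limit exists for every $t\in[0,\infty)$ and is continuous in $t$. **Proposition.** Let $p\in[1,\infty]$ with conjugate exponent $q$ (that is, $1/p+1/q=1$), let $x\in\mathcal L_p$ and $g_n,g\in W^{1,q}$ for $n\in\mathbb N$. Assume that $g_n(x_0)\to g(x_0)$ and that $g_n'\to g'$ in the weak topology of $L^q$ (in the weak$^*$ topology of $L^\infty=(L^1)^*$ if $p=1$). Then the integrals $\int_0^{t} g_n(x_s)\,dx_s$ and $\int_0^{t} g(x_s)\,dx_s$ exist, and $$\int_0^{t} g_n(x_s)\,dx_s\longrightarrow\int_0^{t} g(x_s)\,dx_s\quad\text{for all }t\in[0,\infty).$$ If moreover $|g_n'|\to|g'|$ weakly (weakly$^*$ if $p=1$) in $L^q$, then the convergence is uniform in $t$ on compact subsets of $[0,\infty)$.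 -/

import Mathlib

open MeasureTheory Filter Topology
open scoped ENNReal NNReal

noncomputable section

/-- A partition `0 = t₀ < t₁ < ⋯` of `[0, ∞)`: the points lie in `[0, ∞]`, they increase strictly
as long as they are finite, and they tend to `∞` (they may be `∞` from some index on). -/
structure TimePartition where
  pt : ℕ → ℝ≥0∞
  pt_zero : pt 0 = 0
  pt_lt_succ : ∀ k, pt (k + 1) < ∞ → pt k < pt (k + 1)
  tendsto_pt : Tendsto pt atTop (𝓝 ∞)

namespace TimePartition

/-- The time `t_k ∧ t`. -/
def trunc (π : TimePartition) (t : ℝ≥0) (k : ℕ) : ℝ≥0 :=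
  (min (π.pt k) (t : ℝ≥0∞)).toNNReal

theorem trunc_of_le (π : TimePartition) {t : ℝ≥0} {k : ℕ} (h : (t : ℝ≥0∞) ≤ π.pt k) :
    π.trunc t k = t := by
  simp [trunc, min_eq_right h]

/-- Only finitely many indices `k` have `t_k ∧ t ≠ t_{k+1} ∧ t`, so that the sums below, which
run over all `k`, are finite sums. -/
theorem finite_trunc_ne (π : TimePartition) (t : ℝ≥0) :
    {k | π.trunc t k ≠ π.trunc t (k + 1)}.Finite := by
  have h : ∀ᶠ k in atTop, (t : ℝ≥0∞) < π.pt k :=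
    π.tendsto_pt.eventually (lt_mem_nhds ENNReal.coe_lt_top)
  obtain ⟨N, hN⟩ := eventually_atTop.1 h
  refine (Set.finite_lt_nat N).subset fun k hk => ?_
  by_contra hlt
  have hle : N ≤ k := not_lt.1 hlt
  exact hk (by rw [π.trunc_of_le (hN k hle).le, π.trunc_of_le (hN (k + 1) (by omega)).le])

/-- The oscillation `O_T(x, π)`: the supremum of `|x(b) - x(a)|` over all
`a, b ∈ [t_k, t_{k+1}) ∩ [0, T]` and all `k`. -/
def osc (π : TimePartition) (x : ℝ≥0 → ℝ) (T : ℝ≥0) : ℝ≥0∞ :=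
  ⨆ (k : ℕ) (a : ℝ≥0) (b : ℝ≥0)
    (_ : π.pt k ≤ a ∧ (a : ℝ≥0∞) < π.pt (k + 1) ∧ a ≤ T)
    (_ : π.pt k ≤ b ∧ (b : ℝ≥0∞) < π.pt (k + 1) ∧ b ≤ T), ENNReal.ofReal |x b - x a|

/-- The non-anticipative Riemann sum `∑_k g(x_{t_k}) (x_{t_{k+1} ∧ t} - x_{t_k ∧ t})`.
(Where `t_k = ∞` the increment vanishes, so the value of `x` at `∞` plays no role.) -/
def riemannSum (π : TimePartition) (x : ℝ≥0 → ℝ) (g : ℝ → ℝ) (t : ℝ≥0) : ℝ :=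
  ∑ᶠ k : ℕ, g (x (π.pt k).toNNReal) * (x (π.trunc t (k + 1)) - x (π.trunc t k))

/-- The discrete local time
`L^π_t(u) = 2 ∑_k 1_{⟦x_{t_k ∧ t}, x_{t_{k+1} ∧ t})}(u) |x_{t_{k+1} ∧ t} - u|`, where `⟦a, b)` is
`[a, b)` if `a ≤ b` and `[b, a)` otherwise. -/
def localTime (π : TimePartition) (x : ℝ≥0 → ℝ) (t : ℝ≥0) (u : ℝ) : ℝ :=
  2 * ∑ᶠ k : ℕ,
    (Set.Ico (min (x (π.trunc t k)) (x (π.trunc t (k + 1))))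
      (max (x (π.trunc t k)) (x (π.trunc t (k + 1))))).indicator
        (fun v => |x (π.trunc t (k + 1)) - v|) u

end TimePartition

/-- `F n → G` in the topology `σ(L^r, L^{r'})` of `L^r(ℝ, du)`, with `r'` the exponent conjugate
to `r`: the weak topology if `1 ≤ r < ∞`, and the weak* topology of `L^∞ = (L^1)*` if `r = ∞`. -/
def WeakLpTendsto (r : ℝ≥0∞) (F : ℕ → ℝ → ℝ) (G : ℝ → ℝ) : Prop :=
  (∀ n, MemLp (F n) r volume) ∧ MemLp G r volume ∧
    ∀ h : ℝ → ℝ, MemLp h r.conjExponent volume →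
      Tendsto (fun n => ∫ u, F n u * h u) atTop (𝓝 (∫ u, G u * h u))

/-- The class `𝓛_p` of paths that admit a pathwise local time in `L^p` along the sequence of
partitions `P`: `x` is continuous, its oscillation along `P` vanishes, and for every `t` the
discrete local times converge weakly (weakly* if `p = ∞`) in `L^p` to some `L_t`, with
`t ↦ L_t` continuous for the weak (weak*) topology. -/
def LocalTimeClass (P : ℕ → TimePartition) (p : ℝ≥0∞) : Set (ℝ≥0 → ℝ) :=
  {x | Continuous x ∧
    (∀ T : ℝ≥0, Tendsto (fun n => (P n).osc x T) atTop (𝓝 0)) ∧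
    ∃ L : ℝ≥0 → ℝ → ℝ,
      (∀ t, WeakLpTendsto p (fun n => (P n).localTime x t) (L t)) ∧
      ∀ h : ℝ → ℝ, MemLp h p.conjExponent volume → Continuous fun t => ∫ u, L t u * h u}

/-- The Sobolev space `W^{1,q}` in the sense of functions with first derivative in `L^q(ℝ)`
(no integrability of `g` itself): `g` is absolutely continuous on every compact interval and its
a.e. derivative is in `L^q`. -/
def MemW1 (g : ℝ → ℝ) (q : ℝ≥0∞) : Prop :=
  (∀ a b : ℝ, AbsolutelyContinuousOnInterval g a b) ∧ MemLp (deriv g) q volume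

/-- Föllmer's integral `∫₀ᵗ g(x_s) dx_s`, the limit of the Riemann sums along `P`. -/
def follmerIntegral (P : ℕ → TimePartition) (x : ℝ≥0 → ℝ) (g : ℝ → ℝ) (t : ℝ≥0) : ℝ :=
  limUnder atTop fun n => (P n).riemannSum x g t

/-- Föllmer's integral of `g(x)` exists: at every `t` the Riemann sums do converge, and the limit
is continuous in `t`. -/
def FollmerIntegrable (P : ℕ → TimePartition) (x : ℝ≥0 → ℝ) (g : ℝ → ℝ) : Prop :=
  (∀ t, Tendsto (fun n => (P n).riemannSum x g t) atTop (𝓝 (follmerIntegral P x g t))) ∧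
    Continuous (follmerIntegral P x g)

end

/-! On each partition interval, Taylor's formula with integral remainder
(`integral_eq_add_integral_crossing`) writes the Riemann summand as an increment of the primitive of
g minus a pairing of g' with a crossing kernel. These kernels add up to half the discrete local time
(`TimePartition.riemannSum_eq`), so weak convergence of local times gives ∫₀ᵗ g(x) dx = ∫_{x₀}^{x_t}
g - ½ ∫ L_t g'. Up to the term g(x₀)(x_t - x₀), the right side pairs g' with functions in L^p,
whence the pointwise claim.

For uniformity, both kernel families are increasing: L_t in t (`ae_le_of_localTime_tendsto`), and
the crossing kernel from a fixed low level a in its endpoint (`monotone_crossing_max`). Splitting f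
= |f| - (|f| - f) makes each pairing a difference of monotone functions with continuous limits, and
Pólya's theorem applies (`tendstoLocallyUniformly_integral_kernel`). -/

/-! ### Crossing kernels and Taylor's formula -/

/-- The kernel `1_{⟦a, b)}(u) |b - u|`. -/
noncomputable def crossing (a b u : ℝ) : ℝ :=
  (Set.Ico (min a b) (max a b)).indicator (fun v => |b - v|) u

@[simp]
theorem crossing_self (a u : ℝ) : crossing a a u = 0 := by
  simp [crossing]

theorem crossing_nonneg (a b u : ℝ) : 0 ≤ crossing a b u :=
  Set.indicator_nonneg (fun _ _ => abs_nonneg _) u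

theorem crossing_le (a b u : ℝ) : crossing a b u ≤ |b - a| := by
  refine Set.indicator_le' (fun v hv => ?_) (fun _ _ => abs_nonneg _) u
  rcases le_total a b with h | h
  · rw [min_eq_left h, max_eq_right h] at hv
    rw [abs_of_nonneg (by linarith [hv.2]), abs_of_nonneg (by linarith)]
    linarith [hv.1]
  · rw [min_eq_right h, max_eq_left h] at hv
    rw [abs_of_nonpos (by linarith [hv.1]), abs_of_nonpos (by linarith)]
    linarith [hv.2]

/-- For b ≥ a the kernel is (b - u)⁺ restricted to u ≥ a. The maximum is needed because below a the
kernel grows as b decreases. -/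
theorem monotone_crossing_max (a u : ℝ) : Monotone fun y => crossing a (max a y) u := by
  intro y z hyz
  have h1 : a ≤ max a y := le_max_left _ _
  have h2 : max a y ≤ max a z := max_le_max le_rfl hyz
  change crossing a (max a y) u ≤ crossing a (max a z) u
  generalize max a y = b at *
  generalize max a z = c at *
  by_cases hu : u ∈ Set.Ico a b
  · have hu' : u ∈ Set.Ico a c := ⟨hu.1, hu.2.trans_le h2⟩
    simp only [crossing, min_eq_left h1, max_eq_right h1, min_eq_left (h1.trans h2),
      max_eq_right (h1.trans h2), Set.indicator_of_mem hu, Set.indicator_of_mem hu']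
    rw [abs_of_nonneg (by linarith [hu.2]), abs_of_nonneg (by linarith [hu.2])]
    linarith
  · have : crossing a b u = 0 := by
      simp only [crossing, min_eq_left h1, max_eq_right h1, Set.indicator_of_notMem hu]
    rw [this]
    exact crossing_nonneg _ _ _

theorem memLp_crossing (a b : ℝ) (r : ℝ≥0∞) : MemLp (crossing a b) r volume := by
  refine HasCompactSupport.memLp_of_bound
    (HasCompactSupport.intro (K := Set.Icc (min a b) (max a b)) isCompact_Icc fun u hu => ?_) ?_
    |b - a| (.of_forall fun u => ?_)
  · exact Set.indicator_of_notMem (fun h => hu ⟨h.1, h.2.le⟩) _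
  · exact (Measurable.indicator (by fun_prop) measurableSet_Ico).aestronglyMeasurable
  · rw [Real.norm_of_nonneg (crossing_nonneg a b u)]
    exact crossing_le a b u

theorem crossing_mul_of_le {a b : ℝ} (hab : a ≤ b) (h : ℝ → ℝ) :
    (fun u => crossing a b u * h u) = (Set.Ico a b).indicator fun u => (b - u) * h u := by
  funext u
  simp only [crossing, min_eq_left hab, max_eq_right hab]
  by_cases hu : u ∈ Set.Ico a b
  · rw [Set.indicator_of_mem hu, Set.indicator_of_mem hu, abs_of_nonneg (by linarith [hu.2])]
  · rw [Set.indicator_of_notMem hu, Set.indicator_of_notMem hu, zero_mul]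

theorem crossing_mul_of_ge {a b : ℝ} (hab : b ≤ a) (h : ℝ → ℝ) :
    (fun u => crossing a b u * h u) = (Set.Ico b a).indicator fun u => -((b - u) * h u) := by
  funext u
  simp only [crossing, min_eq_right hab, max_eq_left hab]
  by_cases hu : u ∈ Set.Ico b a
  · rw [Set.indicator_of_mem hu, Set.indicator_of_mem hu, abs_of_nonpos (by linarith [hu.1])]
    ring
  · rw [Set.indicator_of_notMem hu, Set.indicator_of_notMem hu, zero_mul]

/-- When b < a, the sign from |b - u| = -(b - u) is absorbed by the orientation of the interval
integral. -/
theorem integral_crossing_mul (a b : ℝ) (h : ℝ → ℝ) :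
    ∫ u, crossing a b u * h u = ∫ u in a..b, (b - u) * h u := by
  rcases le_total a b with hab | hab
  · rw [crossing_mul_of_le hab, integral_indicator measurableSet_Ico, integral_Ico_eq_integral_Ioc,
      intervalIntegral.integral_of_le hab]
  · rw [crossing_mul_of_ge hab, integral_indicator measurableSet_Ico, integral_Ico_eq_integral_Ioc,
      intervalIntegral.integral_of_ge hab, integral_neg]

theorem integrable_crossing_mul {h : ℝ → ℝ} (hh : LocallyIntegrable h volume) (a b : ℝ) :
    Integrable fun u => crossing a b u * h u := by
  have key : ∀ c d : ℝ, IntegrableOn (fun u => (b - u) * h u) (Set.Ico c d) := fun c d =>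
    ((hh.integrableOn_isCompact isCompact_Icc).continuousOn_mul
      (by fun_prop) isCompact_Icc).mono_set Set.Ico_subset_Icc_self
  rcases le_total a b with hab | hab
  · rw [crossing_mul_of_le hab, integrable_indicator_iff measurableSet_Ico]
    exact key a b
  · rw [crossing_mul_of_ge hab, integrable_indicator_iff measurableSet_Ico]
    exact (key b a).neg

/-- Expanding b - u takes b out of the integrand and leaves two primitives. -/
theorem continuous_integral_crossing_mul {h : ℝ → ℝ} (hh : LocallyIntegrable h volume) (a : ℝ) :
    Continuous fun b => ∫ u, crossing a b u * h u := by
  have h1 : ∀ c d, IntervalIntegrable h volume c d := fun c d =>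
    (hh.integrableOn_isCompact isCompact_uIcc).intervalIntegrable
  have h2 : ∀ c d, IntervalIntegrable (fun u => u * h u) volume c d := fun c d =>
    (h1 c d).continuousOn_mul (by fun_prop)
  have : (fun b => ∫ u, crossing a b u * h u)
      = fun b => b * (∫ u in a..b, h u) - ∫ u in a..b, u * h u := by
    funext b
    rw [integral_crossing_mul, ← intervalIntegral.integral_const_mul,
      ← intervalIntegral.integral_sub ((h1 a b).const_mul b) (h2 a b)]
    simp only [sub_mul]
  rw [this]
  exact (continuous_id.mul (intervalIntegral.continuous_primitive h1 a)).sub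
    (intervalIntegral.continuous_primitive h2 a)

theorem continuous_of_absolutelyContinuousOnInterval {g : ℝ → ℝ}
    (hg : ∀ a b : ℝ, AbsolutelyContinuousOnInterval g a b) : Continuous g :=
  continuous_iff_continuousAt.2 fun y =>
    (hg (y - 1) (y + 1)).continuousOn.continuousAt <| by
      rw [Set.uIcc_of_le (by linarith)]
      exact Icc_mem_nhds (by linarith) (by linarith)

/-- First order Taylor formula for the primitive of an absolutely continuous function. -/
theorem integral_eq_add_integral_crossing {g : ℝ → ℝ} {a b : ℝ}
    (hg : AbsolutelyContinuousOnInterval g a b) :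
    ∫ u in a..b, g u = g a * (b - a) + ∫ u, crossing a b u * deriv g u := by
  have hlin : AbsolutelyContinuousOnInterval (fun u => b - u) a b :=
    ContDiffOn.absolutelyContinuousOnInterval (by fun_prop)
  rw [integral_crossing_mul, hlin.integral_mul_deriv_eq_deriv_mul hg]
  simp
  ring

/-! ### Discrete identities and estimates along one partition -/

namespace TimePartition

variable (π : TimePartition)

theorem monotone_pt : Monotone π.pt := by
  refine monotone_nat_of_le_succ fun k => ?_
  rcases eq_or_ne (π.pt (k + 1)) ∞ with h | h
  · simp [h]
  · exact (π.pt_lt_succ k h.lt_top).le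

theorem trunc_zero (t : ℝ≥0) : π.trunc t 0 = 0 := by
  simp [trunc, π.pt_zero]

theorem trunc_of_ge {t : ℝ≥0} {k : ℕ} (h : π.pt k ≤ t) :
    π.trunc t k = (π.pt k).toNNReal := by
  simp [trunc, min_eq_left h]

theorem eventually_trunc_eq (t : ℝ≥0) : ∃ N, ∀ k, N ≤ k → π.trunc t k = t := by
  obtain ⟨N, hN⟩ := eventually_atTop.1
    (π.tendsto_pt.eventually (lt_mem_nhds (ENNReal.coe_lt_top (r := t))))
  exact ⟨N, fun k hk => π.trunc_of_le (hN k hk).le⟩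

theorem localTime_eq_sum (x : ℝ≥0 → ℝ) {t : ℝ≥0} {N : ℕ} (hN : ∀ k, N ≤ k → π.trunc t k = t)
    (u : ℝ) :
    π.localTime x t u
      = 2 * ∑ k ∈ Finset.range N, crossing (x (π.trunc t k)) (x (π.trunc t (k + 1))) u := by
  rw [localTime]
  congr 1
  refine finsum_eq_sum_of_support_subset
    (f := fun k => crossing (x (π.trunc t k)) (x (π.trunc t (k + 1))) u) fun k hk => ?_
  by_contra hlt
  have hle : N ≤ k := by simpa using hlt
  refine hk ?_
  simp only
  rw [hN k hle, hN (k + 1) (by omega), crossing_self]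

theorem riemannSum_eq_sum (x : ℝ≥0 → ℝ) (g : ℝ → ℝ) {t : ℝ≥0} {N : ℕ}
    (hN : ∀ k, N ≤ k → π.trunc t k = t) :
    π.riemannSum x g t = ∑ k ∈ Finset.range N,
      g (x (π.trunc t k)) * (x (π.trunc t (k + 1)) - x (π.trunc t k)) := by
  rw [riemannSum, finsum_eq_sum_of_support_subset (s := Finset.range N)]
  · refine Finset.sum_congr rfl fun k _ => ?_
    rcases le_total (π.pt k) t with h | h
    · rw [π.trunc_of_ge h]
    -- The increment vanishes here, so the value of g is irrelevant, even at the default `toNNReal ∞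
    -- = 0`.
    · rw [π.trunc_of_le h, π.trunc_of_le (h.trans (π.monotone_pt k.le_succ))]
      simp
  · intro k hk
    by_contra hlt
    have hle : N ≤ k := by simpa using hlt
    refine hk ?_
    simp only
    rw [hN k hle, hN (k + 1) (by omega), sub_self, mul_zero]

/-- The discrete Tanaka–Meyer formula. -/
theorem riemannSum_eq (x : ℝ≥0 → ℝ) {g : ℝ → ℝ}
    (hg : ∀ a b : ℝ, AbsolutelyContinuousOnInterval g a b)
    (hloc : LocallyIntegrable (deriv g) volume) (t : ℝ≥0) :
    π.riemannSum x g t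
      = (∫ u in x 0..x t, g u) - 1 / 2 * ∫ u, π.localTime x t u * deriv g u := by
  obtain ⟨N, hN⟩ := π.eventually_trunc_eq t
  have hcont := continuous_of_absolutelyContinuousOnInterval hg
  have hL : ∫ u, π.localTime x t u * deriv g u = 2 * ∑ k ∈ Finset.range N,
      ∫ u, crossing (x (π.trunc t k)) (x (π.trunc t (k + 1))) u * deriv g u := by
    rw [← integral_finsetSum _ fun k _ => integrable_crossing_mul hloc _ _, ← integral_const_mul]
    congr 1 with u
    rw [π.localTime_eq_sum x hN, mul_assoc, Finset.sum_mul]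
  have hF : ∫ u in x 0..x t, g u = ∑ k ∈ Finset.range N,
      ∫ u in x (π.trunc t k)..x (π.trunc t (k + 1)), g u := by
    rw [intervalIntegral.sum_integral_adjacent_intervals (a := fun k => x (π.trunc t k))
      fun k _ => hcont.intervalIntegrable _ _, π.trunc_zero, hN N le_rfl]
  rw [hL, hF, π.riemannSum_eq_sum x g hN, ← mul_assoc, one_div, inv_mul_cancel₀ two_ne_zero,
    one_mul, ← Finset.sum_sub_distrib]
  refine Finset.sum_congr rfl fun k _ => ?_
  rw [integral_eq_add_integral_crossing (hg _ _)]
  ring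

theorem abs_sub_le_of_osc_le {x : ℝ≥0 → ℝ} {T : ℝ≥0} {ε : ℝ} (hε : 0 ≤ ε)
    (h : π.osc x T ≤ ENNReal.ofReal ε) {k : ℕ} {a b : ℝ≥0}
    (ha : π.pt k ≤ a ∧ (a : ℝ≥0∞) < π.pt (k + 1) ∧ a ≤ T)
    (hb : π.pt k ≤ b ∧ (b : ℝ≥0∞) < π.pt (k + 1) ∧ b ≤ T) : |x b - x a| ≤ ε := by
  refine (ENNReal.ofReal_le_ofReal_iff hε).1 (le_trans ?_ h)
  exact le_iSup_of_le k <| le_iSup_of_le a <| le_iSup_of_le b <| le_iSup_of_le ha <|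
    le_iSup_of_le hb le_rfl

/-- The discrete local time is increasing in time, up to the oscillation. -/
theorem localTime_le_add (x : ℝ≥0 → ℝ) {s t : ℝ≥0} (hst : s ≤ t) {ε : ℝ} (hε : 0 ≤ ε)
    (h : π.osc x s ≤ ENNReal.ofReal ε) (u : ℝ) :
    π.localTime x s u ≤ π.localTime x t u + 2 * ε := by
  obtain ⟨N₁, hN₁⟩ := π.eventually_trunc_eq s
  obtain ⟨N₂, hN₂⟩ := π.eventually_trunc_eq t
  have hst' : (s : ℝ≥0∞) ≤ t := by exact_mod_cast hst
  rw [π.localTime_eq_sum x (N := max N₁ N₂) fun k hk => hN₁ k (le_of_max_le_left hk),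
    π.localTime_eq_sum x (N := max N₁ N₂) fun k hk => hN₂ k (le_of_max_le_right hk), ← mul_add]
  refine mul_le_mul_of_nonneg_left ?_ zero_le_two
  -- An interval without s in its interior contributes at time s either nothing or exactly what it
  -- contributes at time t.
  have hout : ∀ k, ¬(π.pt k < s ∧ s < π.pt (k + 1)) →
      crossing (x (π.trunc s k)) (x (π.trunc s (k + 1))) u
        ≤ crossing (x (π.trunc t k)) (x (π.trunc t (k + 1))) u := by
    intro k hk
    rcases le_or_gt (s : ℝ≥0∞) (π.pt k) with h1 | h1
    · rw [π.trunc_of_le h1, π.trunc_of_le (h1.trans (π.monotone_pt k.le_succ)), crossing_self]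
      exact crossing_nonneg _ _ _
    · have h2 : π.pt (k + 1) ≤ s := not_lt.1 fun h2 => hk ⟨h1, h2⟩
      rw [π.trunc_of_ge h1.le, π.trunc_of_ge h2, π.trunc_of_ge (h1.le.trans hst'),
        π.trunc_of_ge (h2.trans hst')]
  by_cases hex : ∃ j, π.pt j < s ∧ s < π.pt (j + 1)
  · obtain ⟨j, hj1, hj2⟩ := hex
    -- Only the interval around s can lose mass, if the path turns back after s; its term at s is at
    -- most |x_s - x_{t_j}| ≤ ε.
    have hterm : ∀ k, crossing (x (π.trunc s k)) (x (π.trunc s (k + 1))) u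
        ≤ crossing (x (π.trunc t k)) (x (π.trunc t (k + 1))) u + if k = j then ε else 0 := by
      intro k
      split_ifs with hkj
      · subst hkj
        have hfin : ((π.pt k).toNNReal : ℝ≥0∞) = π.pt k := ENNReal.coe_toNNReal hj1.ne_top
        rw [π.trunc_of_ge hj1.le, π.trunc_of_le hj2.le]
        have hb := π.abs_sub_le_of_osc_le hε h (k := k) (a := (π.pt k).toNNReal) (b := s)
          ⟨hfin.ge, hfin.trans_lt (hj1.trans hj2), by
            rw [← ENNReal.coe_le_coe, hfin]; exact hj1.le⟩ ⟨hj1.le, hj2, le_rfl⟩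
        linarith [crossing_le (x (π.pt k).toNNReal) (x s) u,
          crossing_nonneg (x (π.trunc t k)) (x (π.trunc t (k + 1))) u]
      · rw [add_zero]
        refine hout k fun hk => ?_
        rcases lt_or_gt_of_ne hkj with hlt | hlt
        · exact absurd (hk.2.trans_le (π.monotone_pt hlt)) hj1.not_gt
        · exact absurd (hj2.trans_le (π.monotone_pt hlt)) hk.1.not_gt
    refine (Finset.sum_le_sum fun k _ => hterm k).trans ?_
    rw [Finset.sum_add_distrib, Finset.sum_ite_eq']
    gcongr
    split_ifs <;> linarith
  · exact (Finset.sum_le_sum fun k _ => hout k fun hk => hex ⟨k, hk⟩).trans (by linarith)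

end TimePartition

/-! ### Tools for uniform convergence -/

/-- Pólya's theorem: pointwise convergence of monotone functions to a continuous function is
locally uniform. -/
theorem tendstoLocallyUniformly_of_monotone {ι : Type*} [LinearOrder ι] [TopologicalSpace ι]
    [OrderTopology ι] {f : ℕ → ι → ℝ} {f₀ : ι → ℝ}
    (hmono : ∀ n, Monotone (f n)) (hcont : Continuous f₀)
    (hlim : ∀ t, Tendsto (fun n => f n t) atTop (𝓝 (f₀ t))) :
    TendstoLocallyUniformly f f₀ atTop := by
  rw [Metric.tendstoLocallyUniformly_iff]
  intro ε hε t₀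
  have hε3 : 0 < ε / 3 := by positivity
  obtain ⟨c, d, ht, hnhds, hsub⟩ := exists_Icc_mem_subset_of_mem_nhds
    (hcont.continuousAt.preimage_mem_nhds (Metric.ball_mem_nhds (f₀ t₀) hε3))
  refine ⟨Set.Icc c d, hnhds, ?_⟩
  have hcd : c ≤ d := ht.1.trans ht.2
  -- Monotonicity squeezes `f n y` between its values at c and d, so convergence at these two points
  -- suffices.
  filter_upwards [Metric.tendsto_nhds.1 (hlim c) _ hε3, Metric.tendsto_nhds.1 (hlim d) _ hε3]
    with n hc hd y hy
  have h1 := hsub hy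
  have h2 := hsub (Set.left_mem_Icc.2 hcd)
  have h3 := hsub (Set.right_mem_Icc.2 hcd)
  simp only [Set.mem_preimage, Metric.mem_ball, Real.dist_eq, abs_lt] at h1 h2 h3 hc hd
  have h4 := hmono n hy.1
  have h5 := hmono n hy.2
  rw [Real.dist_eq, abs_lt]
  constructor <;> linarith [h1.1, h1.2, h2.1, h2.2, h3.1, h3.2, hc.1, hc.2, hd.1, hd.2]

/-- The primitive of `g` based at `x₀`, in terms of the kernels `crossing a`, for `a` below. -/
theorem integral_eq_integral_crossing_max {g : ℝ → ℝ}
    (hg : ∀ a b : ℝ, AbsolutelyContinuousOnInterval g a b) {a x₀ y : ℝ} (h0 : a ≤ x₀)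
    (hy : a ≤ y) :
    ∫ u in x₀..y, g u = g a * (y - x₀) + ((∫ u, crossing a (max a y) u * deriv g u)
      - ∫ u, crossing a (max a x₀) u * deriv g u) := by
  have hcont := continuous_of_absolutelyContinuousOnInterval hg
  rw [← intervalIntegral.integral_interval_sub_left (hcont.intervalIntegrable a y)
    (hcont.intervalIntegrable a x₀), integral_eq_add_integral_crossing (hg a y),
    integral_eq_add_integral_crossing (hg a x₀), max_eq_right h0, max_eq_right hy]
  ring

theorem tendstoUniformlyOn_mul_of_bounded {ι : Type*} {c : ℕ → ℝ} {c₀ : ℝ} {φ : ι → ℝ} {s : Set ι}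
    {B : ℝ} (hc : Tendsto c atTop (𝓝 c₀)) (hφ : ∀ t ∈ s, |φ t| ≤ B) :
    TendstoUniformlyOn (fun n t => c n * φ t) (fun t => c₀ * φ t) atTop s := by
  rw [Metric.tendstoUniformlyOn_iff]
  intro ε hε
  have h0 : Tendsto (fun n => |c₀ - c n| * B) atTop (𝓝 0) := by
    simpa using (hc.const_sub c₀).abs.mul_const B
  filter_upwards [h0.eventually (gt_mem_nhds hε)] with n hn t ht
  rw [Real.dist_eq, ← sub_mul, abs_mul]
  exact (mul_le_mul_of_nonneg_left (hφ t ht) (abs_nonneg _)).trans_lt hn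

/-! ### Dual pairings and limits of local times -/

section Kernels

variable {p q : ℝ≥0∞} [ENNReal.HolderConjugate p q]

theorem integrable_mul_of_memLp {f h : ℝ → ℝ} (hf : MemLp f p volume) (hh : MemLp h q volume) :
    Integrable fun u => f u * h u :=
  hf.integrable_mul hh

/-- Weak convergence together with weak convergence of the absolute values gives locally uniform
convergence of the pairings with an increasing, weakly continuous family of kernels. -/
theorem tendstoLocallyUniformly_integral_kernel {ι : Type*} [LinearOrder ι]
    [TopologicalSpace ι] [OrderTopology ι] {K : ι → ℝ → ℝ} (hK : ∀ t, MemLp (K t) p volume)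
    (hmono : ∀ s t, s ≤ t → K s ≤ᵐ[volume] K t)
    (hcont : ∀ h : ℝ → ℝ, MemLp h q volume → Continuous fun t => ∫ u, K t u * h u)
    {f : ℕ → ℝ → ℝ} {f₀ : ℝ → ℝ} (hf : WeakLpTendsto q f f₀)
    (habs : WeakLpTendsto q (fun n u => |f n u|) (fun u => |f₀ u|)) :
    TendstoLocallyUniformly (fun n t => ∫ u, K t u * f n u) (fun t => ∫ u, K t u * f₀ u)
      atTop := by
  have hqp : q.conjExponent = p := ENNReal.HolderConjugate.conjExponent_eq
  have hmonoInt : ∀ h : ℝ → ℝ, MemLp h q volume → (∀ u, 0 ≤ h u) →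
      Monotone fun t => ∫ u, K t u * h u := fun h hh h0 s t hst => by
    refine integral_mono_ae (integrable_mul_of_memLp (hK s) hh)
      (integrable_mul_of_memLp (hK t) hh) ?_
    filter_upwards [hmono s t hst] with u hu
    exact mul_le_mul_of_nonneg_right hu (h0 u)
  have hlim : ∀ t, Tendsto (fun n => ∫ u, K t u * f n u) atTop (𝓝 (∫ u, K t u * f₀ u)) :=
    fun t => by simpa only [mul_comm] using hf.2.2 (K t) (hqp ▸ hK t)
  have hlimAbs : ∀ t, Tendsto (fun n => ∫ u, K t u * |f n u|) atTop
      (𝓝 (∫ u, K t u * |f₀ u|)) :=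
    fun t => by simpa only [mul_comm] using habs.2.2 (K t) (hqp ▸ hK t)
  have hsub : ∀ (h : ℝ → ℝ), MemLp h q volume → ∀ t,
      ∫ u, K t u * (|h u| - h u) = (∫ u, K t u * |h u|) - ∫ u, K t u * h u := fun h hh t => by
    rw [← integral_sub (integrable_mul_of_memLp (hK t) (h := fun u => |h u|) hh.abs)
      (integrable_mul_of_memLp (hK t) hh)]
    simp only [mul_sub]
  have hA := tendstoLocallyUniformly_of_monotone (f := fun n t => ∫ u, K t u * |f n u|)
    (fun n => hmonoInt _ (habs.1 n) fun u => abs_nonneg _) (hcont _ habs.2.1) hlimAbs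
  have hB := tendstoLocallyUniformly_of_monotone
    (f := fun n t => ∫ u, K t u * (|f n u| - f n u))
    (fun n => hmonoInt _ ((habs.1 n).sub (hf.1 n)) fun u => sub_nonneg.2 (le_abs_self _))
    (hcont (fun u => |f₀ u| - f₀ u) (habs.2.1.sub hf.2.1)) (fun t => by
      simp only [hsub _ (hf.1 _), hsub _ hf.2.1]
      exact (hlimAbs t).sub (hlim t))
  refine ((hA.sub hB).congr fun n t => ?_).congr_right fun t => ?_
  · simp [hsub _ (hf.1 n)]
  · simp [hsub _ hf.2.1]

/-- Local times of a path are increasing in time. -/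
theorem ae_le_of_localTime_tendsto {P : ℕ → TimePartition} {x : ℝ≥0 → ℝ}
    {L : ℝ≥0 → ℝ → ℝ} (hp : 1 ≤ p)
    (hosc : ∀ T : ℝ≥0, Tendsto (fun n => (P n).osc x T) atTop (𝓝 0))
    (hL : ∀ t, WeakLpTendsto p (fun n => (P n).localTime x t) (L t)) {s t : ℝ≥0} (hst : s ≤ t) :
    L s ≤ᵐ[volume] L t := by
  have hint : ∀ {f : ℝ → ℝ}, MemLp f p volume → ∀ A : Set ℝ, volume A < ∞ →
      IntegrableOn f A := fun hf A hA => by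
    have : Fact (volume A < ∞) := ⟨hA⟩
    exact (hf.restrict A).integrable hp
  rw [← eventually_sub_nonneg]
  refine ae_nonneg_of_forall_setIntegral_nonneg_of_sigmaFinite
    (fun A _ hA => hint ((hL t).2.1.sub (hL s).2.1) A hA) fun A hAm hA => ?_
  have hmul : ∀ f : ℝ → ℝ, ∫ u, f u * A.indicator (fun _ => 1) u = ∫ u in A, f u := fun f => by
    rw [← integral_indicator hAm]
    congr 1 with u
    by_cases hu : u ∈ A <;> simp [hu]
  -- Indicators of sets of finite measure are admissible test functions for every exponent.
  have hlim : ∀ r, Tendsto (fun n => ∫ u in A, (P n).localTime x r u) atTop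
      (𝓝 (∫ u in A, L r u)) := fun r => by
    simpa only [hmul] using (hL r).2.2 _ (memLp_indicator_const _ hAm (1 : ℝ) (.inr hA.ne))
  have hεlim : Tendsto (fun n => ((P n).osc x s).toReal) atTop (𝓝 0) := by
    exact (ENNReal.tendsto_toReal ENNReal.zero_ne_top).comp (hosc s)
  have hbound : ∀ᶠ n in atTop, ∫ u in A, (P n).localTime x s u
      ≤ (∫ u in A, (P n).localTime x t u)
        + volume.real A * (2 * ((P n).osc x s).toReal) := by
    -- The oscillation must be finite here, since `toReal` would send ∞ to 0.
    filter_upwards [(hosc s).eventually (gt_mem_nhds ENNReal.zero_lt_top)] with n hn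
    have hc : IntegrableOn (fun _ : ℝ => 2 * ((P n).osc x s).toReal) A :=
      integrableOn_const hA.ne
    rw [← smul_eq_mul (volume.real A), ← setIntegral_const,
      ← integral_add (hint ((hL t).1 n) A hA) hc]
    refine setIntegral_mono (hint ((hL s).1 n) A hA) ((hint ((hL t).1 n) A hA).add hc) fun u => ?_
    exact (P n).localTime_le_add x hst ENNReal.toReal_nonneg (ENNReal.ofReal_toReal hn.ne).ge u
  have := le_of_tendsto_of_tendsto (hlim s)
    ((hlim t).add ((hεlim.const_mul 2).const_mul (volume.real A))) hbound
  simp only [Pi.sub_apply]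
  rw [integral_sub (hint (hL t).2.1 A hA) (hint (hL s).2.1 A hA)]
  simpa using this

theorem MemW1.locallyIntegrable_deriv (hq : 1 ≤ q) {g : ℝ → ℝ} (hg : MemW1 g q) :
    LocallyIntegrable (deriv g) volume :=
  hg.2.locallyIntegrable hq

/-- The Tanaka–Meyer formula: the Riemann sums converge, and the limit is expressed through the
local time. -/
theorem tendsto_riemannSum (hq : 1 ≤ q) {P : ℕ → TimePartition} {x : ℝ≥0 → ℝ}
    {L : ℝ≥0 → ℝ → ℝ}
    (hL : ∀ t, WeakLpTendsto p (fun n => (P n).localTime x t) (L t)) {g : ℝ → ℝ}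
    (hg : MemW1 g q) (t : ℝ≥0) :
    Tendsto (fun n => (P n).riemannSum x g t) atTop
      (𝓝 ((∫ u in x 0..x t, g u) - 1 / 2 * ∫ u, L t u * deriv g u)) := by
  have hpq : p.conjExponent = q := ENNReal.HolderConjugate.conjExponent_eq
  simp only [fun n => (P n).riemannSum_eq x hg.1 (hg.locallyIntegrable_deriv hq) t]
  exact (((hL t).2.2 _ (hpq ▸ hg.2)).const_mul _).const_sub _

/-- Weak convergence of the derivatives and convergence at one point imply pointwise
convergence. -/
theorem tendsto_apply_of_weakLpTendsto_deriv {g : ℕ → ℝ → ℝ} {g₀ : ℝ → ℝ} {x₀ : ℝ}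
    (hg : ∀ n, MemW1 (g n) q) (hg₀ : MemW1 g₀ q)
    (hval : Tendsto (fun n => g n x₀) atTop (𝓝 (g₀ x₀)))
    (hder : WeakLpTendsto q (fun n => deriv (g n)) (deriv g₀)) {a : ℝ} (ha : a ≤ x₀) :
    Tendsto (fun n => g n a) atTop (𝓝 (g₀ a)) := by
  have key : ∀ f : ℝ → ℝ, (∀ a b : ℝ, AbsolutelyContinuousOnInterval f a b) →
      f a = f x₀ - ∫ u, deriv f u * (Set.Ioc a x₀).indicator (fun _ => 1) u := fun f hf => by
    have : ∫ u, deriv f u * (Set.Ioc a x₀).indicator (fun _ => 1) u = ∫ u in a..x₀, deriv f u := by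
      rw [intervalIntegral.integral_of_le ha, ← integral_indicator measurableSet_Ioc]
      congr 1 with u
      by_cases hu : u ∈ Set.Ioc a x₀ <;> simp [hu]
    rw [this, (hf a x₀).integral_deriv_eq_sub]
    ring
  simp only [fun n => key (g n) (hg n).1, key g₀ hg₀.1]
  exact hval.sub (hder.2.2 _ (memLp_indicator_const _ measurableSet_Ioc (1 : ℝ)
    (.inr measure_Ioc_lt_top.ne)))

end Kernels

/-! ### The convergence theorem -/

theorem proposition3p2 (p q : ℝ≥0∞) [ENNReal.HolderConjugate p q]
    (P : ℕ → TimePartition) (x : ℝ≥0 → ℝ) (hx : x ∈ LocalTimeClass P p)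
    (g : ℕ → ℝ → ℝ) (g₀ : ℝ → ℝ) (hg : ∀ n, MemW1 (g n) q) (hg₀ : MemW1 g₀ q)
    (hval : Tendsto (fun n => g n (x 0)) atTop (𝓝 (g₀ (x 0))))
    (hder : WeakLpTendsto q (fun n => deriv (g n)) (deriv g₀)) :
    (∀ n, FollmerIntegrable P x (g n)) ∧ FollmerIntegrable P x g₀ ∧
    (∀ t : ℝ≥0, Tendsto (fun n => follmerIntegral P x (g n) t) atTop
      (𝓝 (follmerIntegral P x g₀ t))) ∧
    (WeakLpTendsto q (fun n u => |deriv (g n) u|) (fun u => |deriv g₀ u|) →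
      ∀ K : Set ℝ≥0, IsCompact K →
        TendstoUniformlyOn (fun n => follmerIntegral P x (g n)) (follmerIntegral P x g₀)
          atTop K) := by
  obtain ⟨hxc, hosc, L, hL, hLc⟩ := hx
  have hpq : p.conjExponent = q := ENNReal.HolderConjugate.conjExponent_eq
  have hqp : q.conjExponent = p := ENNReal.HolderConjugate.conjExponent_eq
  have hp : 1 ≤ p := ENNReal.HolderConjugate.one_le p q
  have hq : 1 ≤ q := ENNReal.HolderConjugate.one_le q p
  rw [hpq] at hLc
  have hformula : ∀ f, MemW1 f q → follmerIntegral P x f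
      = fun t => (∫ u in x 0..x t, f u) - 1 / 2 * ∫ u, L t u * deriv f u := fun f hf => by
    funext t
    exact (tendsto_riemannSum hq hL hf t).limUnder_eq
  have hexists : ∀ f, MemW1 f q → FollmerIntegrable P x f := fun f hf => by
    refine ⟨fun t => ?_, ?_⟩
    · rw [hformula f hf]
      exact tendsto_riemannSum hq hL hf t
    · rw [hformula f hf]
      have hcont := continuous_of_absolutelyContinuousOnInterval hf.1
      exact ((intervalIntegral.continuous_primitive (fun _ _ => hcont.intervalIntegrable _ _)
        (x 0)).comp hxc).sub ((hLc _ hf.2).const_mul _)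
  refine ⟨fun n => hexists _ (hg n), hexists _ hg₀, fun t => ?_, fun habs K hK => ?_⟩
  · simp only [fun n => hformula _ (hg n), hformula _ hg₀]
    have hcross : ∀ a b : ℝ, Tendsto (fun n => ∫ u, crossing a b u * deriv (g n) u) atTop
        (𝓝 (∫ u, crossing a b u * deriv g₀ u)) := fun a b => by
      simpa only [mul_comm] using hder.2.2 _ (memLp_crossing a b _)
    have hloc : Tendsto (fun n => ∫ u, L t u * deriv (g n) u) atTop
        (𝓝 (∫ u, L t u * deriv g₀ u)) := by
      simpa only [mul_comm] using hder.2.2 (L t) (hqp ▸ (hL t).2.1)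
    simp only [fun n => integral_eq_add_integral_crossing ((hg n).1 (x 0) (x t)),
      integral_eq_add_integral_crossing (hg₀.1 (x 0) (x t))]
    exact ((hval.mul_const _).add (hcross _ _)).sub (hloc.const_mul _)
  · obtain ⟨b, hb⟩ := (hK.image hxc).bddBelow
    -- A level below x₀ and the path on K, so that all crossings start at a and the monotone kernels
    -- apply.
    set a := min b (x 0) with ha
    have ha0 : a ≤ x 0 := min_le_right _ _
    have haK : ∀ t ∈ K, a ≤ x t := fun t ht =>
      (min_le_left _ _).trans (hb (Set.mem_image_of_mem x ht))
    have hlocal : TendstoUniformlyOn (fun n t => ∫ u, L t u * deriv (g n) u)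
        (fun t => ∫ u, L t u * deriv g₀ u) atTop K :=
      tendstoLocallyUniformly_iff_forall_isCompact.1 (tendstoLocallyUniformly_integral_kernel
        (fun t => (hL t).2.1) (fun s t hst => ae_le_of_localTime_tendsto hp hosc hL hst)
        hLc hder habs) K hK
    have hcross : TendstoUniformlyOn
        (fun n t => ∫ u, crossing a (max a (x t)) u * deriv (g n) u)
        (fun t => ∫ u, crossing a (max a (x t)) u * deriv g₀ u) atTop K :=
      tendstoLocallyUniformly_iff_forall_isCompact.1 ((tendstoLocallyUniformly_integral_kernel
        (p := p) (K := fun y => crossing a (max a y)) (fun y => memLp_crossing _ _ _)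
        (fun y z hyz => .of_forall fun u => monotone_crossing_max a u hyz)
        (fun h hh => (continuous_integral_crossing_mul (hh.locallyIntegrable hq) a).comp
          (continuous_const.max continuous_id)) hder habs).comp x hxc) K hK
    have hbase : TendstoUniformlyOn
        (fun n (_ : ℝ≥0) => ∫ u, crossing a (max a (x 0)) u * deriv (g n) u)
        (fun _ => ∫ u, crossing a (max a (x 0)) u * deriv g₀ u) atTop K :=
      Tendsto.tendstoUniformlyOn_const (by
        simpa only [mul_comm] using hder.2.2 _ (memLp_crossing a (max a (x 0)) _)) K
    obtain ⟨B, hB⟩ := hK.exists_bound_of_continuousOn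
      (hxc.sub (continuous_const (y := x 0))).continuousOn
    have hlin : TendstoUniformlyOn (fun n t => g n a * (x t - x 0))
        (fun t => g₀ a * (x t - x 0)) atTop K :=
      tendstoUniformlyOn_mul_of_bounded
        (tendsto_apply_of_weakLpTendsto_deriv hg hg₀ hval hder ha0) hB
    have hhalf := (Real.uniformContinuous_const_mul (x := 1 / 2)).comp_tendstoUniformlyOn hlocal
    refine (((hlin.add (hcross.sub hbase)).sub hhalf).congr ?_).congr_right fun t ht => ?_
    · refine .of_forall fun n t ht => ?_
      simp only [hformula _ (hg n), integral_eq_integral_crossing_max (hg n).1 ha0 (haK t ht)]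
      rfl
    · simp only [hformula _ hg₀, integral_eq_integral_crossing_max hg₀.1 ha0 (haK t ht)]
      rfl
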